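/- Let $n\ge 1$ be an integer, $\theta\in(0,\infty)$ and $p,q\in(0,\infty]$, and put $r_0=\frac{n}{n/p+\theta}$ (with $n/\infty=0$). Assume $r_0<\min\{2,q\}$, and $q<r_0'$ whenever $r_0\ge 1$, where $\frac1{r_0}+\frac1{r_0'}=1$ (so $r_0'=\infty$ if $r_0=1$). Then there is a constant $C>0$ depending only on $n,p,q,\theta$ such that $$\frac{\||x|^\theta f\|_{L^p(\mathbb R^n)}}{\|f\|_{L^q(\mathbb R^n)}}\cdot\frac{\||\xi|^\theta \hat f\|_{L^p(\mathbb R^n)}}{\|\hat f\|_{L^q(\mathbb R^n)}}\ \ge\ C\qquad\text{for all } 0\neq f\in L^q(\mathbb R^n)\cap\mathscr F^{-1}L^q(\mathbb R^n).$$ Here $f$ is complex-valued, norms in the numerators may be $+\infty$, and for exponents $s<1$, $\|g\|_{L^s}=(\int|g|^s)^{1/s}$. The Fourier transform is normalised by $\hat f(\xi)=\int_{\mathbb R^n}e^{-ix\cdot\xi}f(x)\,dx$ and is understood in the sense of tempered distributions for $f\in\bigcup_{1\le r\le\infty}L^r(\mathbb R^n)$. Thus $f\in L^q\cap\mathscr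 F^{-1}L^q$ means that $f\in L^q$, that $f\in L^r$ for some $r\in[1,\infty]$ (automatic if $q\ge1$; if $q<1$ it means that $f$ is also integrable), and that $\hat f$ is a function in $L^q$. -/

import Mathlib

open MeasureTheory SchwartzMap
open scoped ENNReal

/-- The classical Fourier integral `∫ e^{-i x·ξ} f(x) dx` on `ℝⁿ`. -/
noncomputable def fourierIntegralHat {n : ℕ} (f : EuclideanSpace ℝ (Fin n) → ℂ)
    (ξ : EuclideanSpace ℝ (Fin n)) : ℂ :=
  ∫ x, Complex.exp (-(Complex.I * ((inner ℝ x ξ : ℝ) : ℂ))) * f x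

/-- The function `g` is the Fourier transform of the function `f` in the sense of tempered
distributions: both are tempered (their products with Schwartz functions are integrable) and
`∫ g φ = ∫ f φ̂` for every Schwartz function `φ`. -/
def IsFourierTransform {n : ℕ} (f g : EuclideanSpace ℝ (Fin n) → ℂ) : Prop :=
  ∀ φ : 𝓢(EuclideanSpace ℝ (Fin n), ℂ),
    Integrable (fun x => f x * fourierIntegralHat φ x) ∧
    Integrable (fun ξ => g ξ * φ ξ) ∧
    ∫ ξ, g ξ * φ ξ = ∫ x, f x * fourierIntegralHat φ x

/-- `f ∈ L^q ∩ 𝓕⁻¹ L^q`, with Fourier transform `fhat`. The Fourier transform is taken on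
`⋃_{1 ≤ r ≤ ∞} L^r`; membership there is automatic when `1 ≤ q` (take `r = q`), while for
`q < 1` it says that `f` is integrable, so that the Fourier integral of `f` converges. -/
structure MemLpFourierLp {n : ℕ} (q : ℝ≥0∞) (f fhat : EuclideanSpace ℝ (Fin n) → ℂ) :
    Prop where
  memLp : MemLp f q volume
  domain : ∃ r : ℝ≥0∞, 1 ≤ r ∧ MemLp f r volume
  isFourierTransform : IsFourierTransform f fhat
  memLp_fourier : MemLp fhat q volume

/-- The exponent `n / (n / p + θ)`, with `n / ∞ = 0`. -/
noncomputable def criticalExponent (n : ℕ) (p : ℝ≥0∞) (θ : ℝ) : ℝ≥0∞ :=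
  (n : ℝ≥0∞) / ((n : ℝ≥0∞) / p + ENNReal.ofReal θ)

/-- The (quasi-)norm `‖ |x|^θ f ‖_{L^p(ℝⁿ)}`, possibly infinite. -/
noncomputable def weightedLpNorm {n : ℕ} (θ : ℝ) (p : ℝ≥0∞)
    (f : EuclideanSpace ℝ (Fin n) → ℂ) : ℝ≥0∞ :=
  eLpNorm (fun x => ((‖x‖ ^ θ : ℝ) : ℂ) * f x) p volume

/-!
The number `ρ = n / (n / p + θ)` satisfies `1 / ρ = 1 / p + θ / n`, so by Hölder's inequality in
Lorentz spaces (`hasWeakBound_of_weightedLpNorm_le`) the weighted norm `‖|x|^θ f‖_p` dominates the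
weak norm `‖f‖_{ρ,∞}`. The weights then play no further role, and what has to be shown is
`‖f‖_q ‖f̂‖_q ≲ ‖f‖_{ρ,∞} ‖f̂‖_{ρ,∞}` (`IsFourierPair.exists_bound`).

The mechanism is a bootstrap. Let `σ ≥ q` be an exponent for which the Fourier transform maps
`L^{σ'}` to `L^σ`, in a weak sense. As `σ'` lies between `ρ` and `σ`, interpolation gives
`‖f̂‖_σ ≲ ‖f‖_{σ'} ≲ ‖f‖_{ρ,∞}^α ‖f‖_σ^{1-α}`. By Fourier inversion the same holds with the roles of
`f` and `f̂` exchanged. Multiplying the two inequalities bounds `‖f‖_σ ‖f̂‖_σ` by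
`‖f‖_{ρ,∞} ‖f̂‖_{ρ,∞}`, because these norms are finite and not zero. Since `ρ < q ≤ σ`, a last
interpolation gives the bound for `q`.

For `ρ < 1` one takes `σ = ∞`, `σ' = 1` (`IsFourierPair.exists_bound_of_lt_one`). For `1 ≤ ρ < 2` the
exponent `s = σ'` is chosen in `(1, 2)`, slightly above `ρ`, which is possible because
`ρ < q < ρ'` (`IsFourierPair.exists_bound_of_lt_two`). All norms except the final one are weak, so
that the mapping property needed is only the weak-type Hausdorff–Young inequality
(`IsFourierPair.hasWeakBound`). It follows from Plancherel and the `L¹`-`L^∞` bound by cutting `f`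
at one height.
-/

/-! ### Weak-type bounds and truncation -/

/-- The function `f` lies in the weak space `L^{r,∞}` with `‖f‖_{r,∞}^r ≤ K`: its distribution
function is at most `K t^{-r}`. Keeping the `r`-th power of the quasi-norm makes every estimate
linear in `K`. -/
def HasWeakBound {α : Type*} [MeasurableSpace α] (μ : Measure α) (r K : ℝ) (f : α → ℂ) : Prop :=
  ∀ t : ℝ, 0 < t → μ {x | t < ‖f x‖} ≤ ENNReal.ofReal (K * t ^ (-r))

theorem lintegral_Ioc_ofReal_rpow {c a T : ℝ} (hc : 0 ≤ c) (ha : -1 < a) (hT : 0 < T) :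
    ∫⁻ t in Set.Ioc 0 T, ENNReal.ofReal (c * t ^ a) =
      ENNReal.ofReal (c * (T ^ (a + 1) / (a + 1))) := by
  have hi : IntervalIntegrable (fun t : ℝ => t ^ a) volume 0 T :=
    intervalIntegral.intervalIntegrable_rpow' ha
  rw [intervalIntegrable_iff_integrableOn_Ioc_of_le hT.le] at hi
  rw [← ofReal_integral_eq_lintegral_ofReal (hi.const_mul c), integral_const_mul,
    ← intervalIntegral.integral_of_le hT.le, integral_rpow (Or.inl ha),
    Real.zero_rpow (by linarith), sub_zero]
  filter_upwards [ae_restrict_mem measurableSet_Ioc] with t ht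
  exact mul_nonneg hc (Real.rpow_nonneg ht.1.le _)

theorem lintegral_Ioi_ofReal_rpow {c a T : ℝ} (hc : 0 ≤ c) (ha : a < -1) (hT : 0 < T) :
    ∫⁻ t in Set.Ioi T, ENNReal.ofReal (c * t ^ a) =
      ENNReal.ofReal (c * (-T ^ (a + 1) / (a + 1))) := by
  have hi := integrableOn_Ioi_rpow_of_lt ha hT
  rw [← ofReal_integral_eq_lintegral_ofReal (hi.const_mul c), integral_const_mul,
    integral_Ioi_rpow_of_lt ha hT]
  filter_upwards [ae_restrict_mem measurableSet_Ioi] with t ht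
  exact mul_nonneg hc (Real.rpow_nonneg (hT.trans ht).le _)

section WeakBound

variable {α : Type*} [MeasurableSpace α] {μ : Measure α} {f : α → ℂ} {r q s K K₀ K₁ T : ℝ}

/-- The part of a weak-`L^r` function below height `T` is in `L^q` for every `q > r`. -/
theorem HasWeakBound.lintegral_indicator_le (h : HasWeakBound μ r K f)
    (hf : AEStronglyMeasurable f μ) (hK : 0 ≤ K) (hq : 0 < q) (hrq : r < q) (hT : 0 < T) :
    ∫⁻ x, ENNReal.ofReal (‖{x | ‖f x‖ ≤ T}.indicator f x‖ ^ q) ∂μ ≤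
      ENNReal.ofReal (q / (q - r) * (K * T ^ (q - r))) := by
  have hS : NullMeasurableSet {x | ‖f x‖ ≤ T} μ :=
    nullMeasurableSet_le hf.norm.aemeasurable aemeasurable_const
  rw [lintegral_rpow_eq_lintegral_meas_lt_mul μ (Filter.Eventually.of_forall fun x => norm_nonneg _)
    (hf.indicator₀ hS).norm.aemeasurable hq]
  have key : ∫⁻ t in Set.Ioi 0, μ {x | t < ‖{x | ‖f x‖ ≤ T}.indicator f x‖} *
      ENNReal.ofReal (t ^ (q - 1)) ≤ ∫⁻ t in Set.Ioi 0, (Set.Ioc 0 T).indicator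
        (fun t => ENNReal.ofReal (K * t ^ (q - r - 1))) t := by
    refine setLIntegral_mono' measurableSet_Ioi fun t ht => ?_
    have ht : 0 < t := ht
    by_cases htT : t ≤ T
    · rw [Set.indicator_of_mem (show t ∈ Set.Ioc 0 T from ⟨ht, htT⟩)]
      have h1 : μ {x | t < ‖{x | ‖f x‖ ≤ T}.indicator f x‖} ≤ μ {x | t < ‖f x‖} :=
        measure_mono fun x hx => lt_of_lt_of_le hx (norm_indicator_le_norm_self _ _)
      refine (mul_le_mul_left (h1.trans (h t ht)) _).trans ?_
      rw [← ENNReal.ofReal_mul (by positivity), mul_assoc, ← Real.rpow_add ht]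
      ring_nf
      rfl
    · have : {x | t < ‖{x | ‖f x‖ ≤ T}.indicator f x‖} = ∅ := by
        ext x
        simp only [Set.mem_ofPred_eq, Set.mem_empty_iff_false, iff_false, not_lt]
        by_cases hx : ‖f x‖ ≤ T
        · rw [Set.indicator_of_mem (by exact hx)]; linarith
        · rw [Set.indicator_of_notMem (by exact hx)]; simpa using ht.le
      rw [this]; simp
  refine (mul_le_mul_right key _).trans ?_
  rw [lintegral_indicator measurableSet_Ioc, Measure.restrict_restrict measurableSet_Ioc,
    Set.inter_eq_left.mpr (fun t ht => ht.1), lintegral_Ioc_ofReal_rpow hK (by linarith) hT,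
    ← ENNReal.ofReal_mul hq.le]
  apply le_of_eq; congr 1
  have : q - r ≠ 0 := by linarith
  rw [show q - r - 1 + 1 = q - r by ring]
  field_simp

/-- The part of a weak-`L^r` function above height `T` is in `L^q` for every `q < r`. -/
theorem HasWeakBound.lintegral_indicator_compl_le (h : HasWeakBound μ r K f)
    (hf : AEStronglyMeasurable f μ) (hK : 0 ≤ K) (hq : 0 < q) (hqr : q < r) (hT : 0 < T) :
    ∫⁻ x, ENNReal.ofReal (‖{x | ‖f x‖ ≤ T}ᶜ.indicator f x‖ ^ q) ∂μ ≤
      ENNReal.ofReal (r / (r - q) * (K * T ^ (q - r))) := by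
  have hS : NullMeasurableSet {x | ‖f x‖ ≤ T} μ :=
    nullMeasurableSet_le hf.norm.aemeasurable aemeasurable_const
  rw [lintegral_rpow_eq_lintegral_meas_lt_mul μ (Filter.Eventually.of_forall fun x => norm_nonneg _)
    (hf.indicator₀ hS.compl).norm.aemeasurable hq,
    ← Set.Ioc_union_Ioi_eq_Ioi hT.le, lintegral_union measurableSet_Ioi Set.Ioc_disjoint_Ioi_same]
  have k1 : ∫⁻ t in Set.Ioc 0 T, μ {x | t < ‖{x | ‖f x‖ ≤ T}ᶜ.indicator f x‖} *
      ENNReal.ofReal (t ^ (q - 1)) ≤ ∫⁻ t in Set.Ioc 0 T,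
        ENNReal.ofReal (K * T ^ (-r) * t ^ (q - 1)) := by
    refine setLIntegral_mono' measurableSet_Ioc fun t ht => ?_
    have h1 : μ {x | t < ‖{x | ‖f x‖ ≤ T}ᶜ.indicator f x‖} ≤ μ {x | T < ‖f x‖} := by
      refine measure_mono fun x (hx : t < _) => ?_
      by_contra hx'
      rw [Set.indicator_of_notMem] at hx
      · simp at hx; linarith [ht.1]
      · simpa using hx'
    refine (mul_le_mul_left (h1.trans (h T hT)) _).trans ?_
    rw [← ENNReal.ofReal_mul (by positivity)]
  have k2 : ∫⁻ t in Set.Ioi T, μ {x | t < ‖{x | ‖f x‖ ≤ T}ᶜ.indicator f x‖} *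
      ENNReal.ofReal (t ^ (q - 1)) ≤ ∫⁻ t in Set.Ioi T,
        ENNReal.ofReal (K * t ^ (q - r - 1)) := by
    refine setLIntegral_mono' measurableSet_Ioi fun t ht => ?_
    have ht : 0 < t := hT.trans ht
    have h1 : μ {x | t < ‖{x | ‖f x‖ ≤ T}ᶜ.indicator f x‖} ≤ μ {x | t < ‖f x‖} :=
      measure_mono fun x hx => lt_of_lt_of_le hx (norm_indicator_le_norm_self _ _)
    refine (mul_le_mul_left (h1.trans (h t ht)) _).trans ?_
    rw [← ENNReal.ofReal_mul (by positivity), mul_assoc, ← Real.rpow_add ht]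
    ring_nf
    rfl
  refine (mul_le_mul_right (add_le_add k1 k2) _).trans ?_
  have hrq : r - q ≠ 0 := by linarith
  have hqr' : q - r ≠ 0 := by linarith
  rw [lintegral_Ioc_ofReal_rpow (by positivity) (by linarith) hT,
    lintegral_Ioi_ofReal_rpow hK (by linarith) hT, show q - r - 1 + 1 = q - r by ring,
    show q - 1 + 1 = q by ring,
    show -T ^ (q - r) / (q - r) = T ^ (q - r) / (r - q) by
      rw [← neg_sub r q, neg_div_neg_eq],
    ← ENNReal.ofReal_add (by positivity)
      (mul_nonneg hK (div_nonneg (by positivity) (by linarith))),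
    ← ENNReal.ofReal_mul hq.le]
  apply le_of_eq; congr 1
  rw [show q - r = -r + q by ring, Real.rpow_add hT]
  field_simp
  ring

/-- A function that is weak-`L^r` and weak-`L^s` with `r < q < s` is in `L^q`. -/
theorem HasWeakBound.lintegral_rpow_le (h₀ : HasWeakBound μ r K₀ f) (h₁ : HasWeakBound μ s K₁ f)
    (hf : AEStronglyMeasurable f μ) (hK₀ : 0 ≤ K₀) (hK₁ : 0 ≤ K₁) (hq : 0 < q) (hrq : r < q)
    (hqs : q < s) (hT : 0 < T) :
    ∫⁻ x, ENNReal.ofReal (‖f x‖ ^ q) ∂μ ≤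
      ENNReal.ofReal (q / (q - r) * (K₀ * T ^ (q - r)) + s / (s - q) * (K₁ * T ^ (q - s))) := by
  have hS : NullMeasurableSet {x | ‖f x‖ ≤ T} μ :=
    nullMeasurableSet_le hf.norm.aemeasurable aemeasurable_const
  have h2 : 0 ≤ q / (q - r) := div_nonneg hq.le (by linarith)
  have h3 : 0 ≤ s / (s - q) := div_nonneg (by linarith) (by linarith)
  rw [ENNReal.ofReal_add (by positivity) (by positivity)]
  refine le_trans (le_of_eq ?_) (add_le_add (h₀.lintegral_indicator_le hf hK₀ hq hrq hT)
    (h₁.lintegral_indicator_compl_le hf hK₁ hq hqs hT))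
  rw [← lintegral_add_left']
  · refine lintegral_congr fun x => ?_
    by_cases hx : ‖f x‖ ≤ T
    · rw [Set.indicator_of_mem (by exact hx), Set.indicator_of_notMem (by simpa using hx)]
      simp [Real.zero_rpow hq.ne']
    · rw [Set.indicator_of_notMem (by exact hx), Set.indicator_of_mem (by exact hx)]
      simp [Real.zero_rpow hq.ne']
  · exact ((hf.indicator₀ hS).norm.aemeasurable.pow_const q).ennreal_ofReal

/-- Interpolation between two weak-type bounds: the weak exponent `θ r + (1 - θ) s` in between
comes with the geometric mean of the constants. -/
theorem HasWeakBound.interpolate {θ : ℝ} (h₀ : HasWeakBound μ r K₀ f) (h₁ : HasWeakBound μ s K₁ f)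
    (hK₀ : 0 ≤ K₀) (hK₁ : 0 ≤ K₁) (hθ : 0 ≤ θ) (hθ' : θ ≤ 1) :
    HasWeakBound μ (θ * r + (1 - θ) * s) (K₀ ^ θ * K₁ ^ (1 - θ)) f := by
  intro t ht
  set m := μ {x | t < ‖f x‖}
  have h0 := h₀ t ht
  have h1 := h₁ t ht
  have : m = m ^ θ * m ^ (1 - θ) := by
    rw [← ENNReal.rpow_add_of_nonneg _ _ hθ (by linarith)]; simp
  rw [this]
  calc m ^ θ * m ^ (1 - θ) ≤ (ENNReal.ofReal (K₀ * t ^ (-r))) ^ θ *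
        (ENNReal.ofReal (K₁ * t ^ (-s))) ^ (1 - θ) :=
        mul_le_mul' (ENNReal.rpow_le_rpow h0 hθ) (ENNReal.rpow_le_rpow h1 (by linarith))
    _ = _ := by
        rw [ENNReal.ofReal_rpow_of_nonneg (by positivity) hθ,
          ENNReal.ofReal_rpow_of_nonneg (by positivity) (by linarith),
          ← ENNReal.ofReal_mul (by positivity), Real.mul_rpow hK₀ (by positivity),
          Real.mul_rpow hK₁ (by positivity), ← Real.rpow_mul ht.le, ← Real.rpow_mul ht.le]
        congr 1
        rw [show -(θ * r + (1 - θ) * s) = -r * θ + -s * (1 - θ) by ring, Real.rpow_add ht]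
        ring

/-- Among all the constants in a weak-type bound there is a least one. -/
theorem HasWeakBound.exists_least (h : HasWeakBound μ r K f) (hK : 0 ≤ K) :
    ∃ M, 0 ≤ M ∧ HasWeakBound μ r M f ∧ ∀ K', 0 ≤ K' → HasWeakBound μ r K' f → M ≤ K' := by
  set S := {K' : ℝ | 0 ≤ K' ∧ HasWeakBound μ r K' f}
  have hS : S.Nonempty := ⟨K, hK, h⟩
  have hb : BddBelow S := ⟨0, fun _ hx => hx.1⟩
  refine ⟨sInf S, le_csInf hS fun _ hx => hx.1, fun t ht => ?_,
    fun K' h0 h' => csInf_le hb ⟨h0, h'⟩⟩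
  have hfin : μ {x | t < ‖f x‖} ≠ ∞ := ne_top_of_le_ne_top ENNReal.ofReal_ne_top (h t ht)
  have htr : 0 < t ^ (-r) := Real.rpow_pos_of_pos ht _
  rw [ENNReal.le_ofReal_iff_toReal_le hfin
    (mul_nonneg (le_csInf hS fun _ hx => hx.1) htr.le), ← div_le_iff₀ htr]
  refine le_csInf hS fun K' hK' => ?_
  rw [div_le_iff₀ htr, ← ENNReal.le_ofReal_iff_toReal_le hfin (mul_nonneg hK'.1 htr.le)]
  exact hK'.2 t ht

theorem HasWeakBound.pos_of_not_ae_eq_zero (h : HasWeakBound μ r K f) (hf : ¬ f =ᵐ[μ] 0) :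
    0 < K := by
  by_contra! hK
  refine hf ?_
  have h0 : ∀ n : ℕ, ∀ᵐ x ∂μ, ‖f x‖ ≤ 1 / ((n : ℝ) + 1) := fun n => by
    have hn : (0 : ℝ) < 1 / ((n : ℝ) + 1) := by positivity
    rw [ae_iff]
    simp only [not_le]
    have := h _ hn
    rwa [ENNReal.ofReal_of_nonpos (mul_nonpos_of_nonpos_of_nonneg hK (by positivity)),
      nonpos_iff_eq_zero] at this
  filter_upwards [ae_all_iff.2 h0] with x hx
  have := ge_of_tendsto' tendsto_one_div_add_atTop_nhds_zero_nat hx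
  simpa using this

/-- Chebyshev's inequality as a weak-type bound. -/
theorem MeasureTheory.MemLp.hasWeakBound (hq : 0 < q) (h : MemLp f (ENNReal.ofReal q) μ) :
    HasWeakBound μ q (((eLpNorm f (ENNReal.ofReal q) μ).toReal) ^ q) f := by
  intro t ht
  have h1 := meas_ge_le_mul_pow_eLpNorm_enorm μ (p := ENNReal.ofReal q) (by simpa using hq)
    ENNReal.ofReal_ne_top h.1 (ε := ENNReal.ofReal t) (by simpa using ht) (by simp)
  rw [ENNReal.toReal_ofReal hq.le] at h1
  refine (measure_mono fun x (hx : t < _) => ?_).trans (h1.trans (le_of_eq ?_))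
  · rw [Set.mem_ofPred_eq, ← ofReal_norm]
    exact ENNReal.ofReal_le_ofReal hx.le
  · nth_rw 1 [← ENNReal.ofReal_toReal h.2.ne]
    rw [← ENNReal.ofReal_inv_of_pos ht, ENNReal.ofReal_rpow_of_nonneg (by positivity) hq.le,
      ENNReal.ofReal_rpow_of_nonneg (by positivity) hq.le, ← ENNReal.ofReal_mul (by positivity),
      Real.rpow_neg ht.le, Real.inv_rpow ht.le, mul_comm]

end WeakBound

/-! ### The Fourier transform of tempered functions -/

section FourierPair

open FourierTransform

variable {V : Type*} [NormedAddCommGroup V] [InnerProductSpace ℝ V] [FiniteDimensional ℝ V]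
  [MeasurableSpace V] [BorelSpace V] {f f₁ f₂ g g₁ g₂ : V → ℂ}

/-- The function `g` is the Fourier transform of `f` in the sense of tempered distributions, for
the unitary normalisation `∫ e^{-2πi x·ξ} f(x) dx`. -/
def IsFourierPair (f g : V → ℂ) : Prop :=
  ∀ φ : 𝓢(V, ℂ), Integrable (fun x => f x * 𝓕 φ x) ∧ Integrable (fun ξ => g ξ * φ ξ) ∧
    ∫ ξ, g ξ * φ ξ = ∫ x, f x * 𝓕 φ x

theorem SchwartzMap.fourier_fourier_apply (φ : 𝓢(V, ℂ)) (x : V) : 𝓕 (𝓕 φ) x = φ (-x) := by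
  have h : 𝓕⁻ (𝓕 φ) (-x) = φ (-x) := by rw [FourierTransform.fourierInv_fourier_eq]
  rw [← h, fourierInv_coe, Real.fourierInv_eq_fourier_neg, neg_neg, fourier_coe]

/-- Fourier inversion: the Fourier transform of `g = 𝓕 f` is the reflection of `f`. -/
theorem IsFourierPair.symm (h : IsFourierPair f g) : IsFourierPair g (fun x => f (-x)) := by
  intro φ
  obtain ⟨h1, h2, h3⟩ := h (𝓕 φ)
  simp only [SchwartzMap.fourier_fourier_apply] at h1 h3
  refine ⟨h2, ?_, ?_⟩
  · simpa using h1.comp_neg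
  · rw [h3, ← integral_neg_eq_self]; simp

theorem IsFourierPair.add (h₁ : IsFourierPair f₁ g₁) (h₂ : IsFourierPair f₂ g₂) :
    IsFourierPair (f₁ + f₂) (g₁ + g₂) := by
  intro φ
  obtain ⟨a1, a2, a3⟩ := h₁ φ
  obtain ⟨b1, b2, b3⟩ := h₂ φ
  simp only [Pi.add_apply, add_mul]
  exact ⟨a1.add b1, a2.add b2, by rw [integral_add a1 b1, integral_add a2 b2, a3, b3]⟩

/-- A function whose products with Schwartz functions are integrable is locally integrable: test with
a bump function. -/
theorem locallyIntegrable_of_forall_schwartz (h : ∀ φ : 𝓢(V, ℂ), Integrable (fun x => g x * φ x)) :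
    LocallyIntegrable g := by
  intro x
  let b : ContDiffBump x := ⟨1, 2, one_pos, one_lt_two⟩
  have hc : HasCompactSupport (fun y => ((b y : ℝ) : ℂ)) :=
    b.hasCompactSupport.comp_left (g := fun r : ℝ => (r : ℂ)) (by simp)
  have hd : ContDiff ℝ ((⊤ : ℕ∞) : WithTop ℕ∞) (fun y => ((b y : ℝ) : ℂ)) := Complex.ofRealCLM.contDiff.comp b.contDiff
  have hi := h (hc.toSchwartzMap hd)
  refine ⟨Metric.closedBall x 1, Metric.closedBall_mem_nhds x one_pos, ?_⟩
  refine hi.integrableOn.congr_fun (fun y hy => ?_) measurableSet_closedBall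
  have : b y = 1 := b.one_of_mem_closedBall hy
  simp [this]

/-- A tempered function has at most one Fourier transform, up to null sets. -/
theorem IsFourierPair.ae_unique (h₁ : IsFourierPair f g₁) (h₂ : IsFourierPair f g₂) :
    g₁ =ᵐ[volume] g₂ := by
  refine ae_eq_of_integral_contDiff_smul_eq
    (locallyIntegrable_of_forall_schwartz fun φ => (h₁ φ).2.1)
    (locallyIntegrable_of_forall_schwartz fun φ => (h₂ φ).2.1) fun φ hφ hc => ?_
  have hc' : HasCompactSupport (fun y => ((φ y : ℝ) : ℂ)) :=
    hc.comp_left (g := fun r : ℝ => (r : ℂ)) (by simp)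
  have hd : ContDiff ℝ ((⊤ : ℕ∞) : WithTop ℕ∞) (fun y => ((φ y : ℝ) : ℂ)) := Complex.ofRealCLM.contDiff.comp hφ
  have := ((h₁ (hc'.toSchwartzMap hd)).2.2).trans ((h₂ (hc'.toSchwartzMap hd)).2.2).symm
  simpa [Complex.real_smul, mul_comm] using this

theorem norm_fourier_le_integral_norm (ξ : V) :
    ‖𝓕 f ξ‖ ≤ ∫ x, ‖f x‖ :=
  VectorFourier.norm_fourierIntegral_le_integral_norm Real.fourierChar volume (innerₗ V) f ξ

theorem MeasureTheory.Integrable.isFourierPair (hf : Integrable f) : IsFourierPair f (𝓕 f) := by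
  intro φ
  have hm : AEStronglyMeasurable (𝓕 f) volume :=
    (VectorFourier.fourierIntegral_continuous Real.continuous_fourierChar
      (L := innerₗ V) (μ := volume) (by exact continuous_inner) hf).aestronglyMeasurable
  refine ⟨?_, ?_, ?_⟩
  · refine hf.mul_bdd (c := ∫ x, ‖φ x‖) ((𝓕 φ).continuous.aestronglyMeasurable) ?_
    exact Filter.Eventually.of_forall fun x => by
      rw [fourier_coe]; exact norm_fourier_le_integral_norm x
  · exact φ.integrable.bdd_mul (c := ∫ x, ‖f x‖) hm
      (Filter.Eventually.of_forall norm_fourier_le_integral_norm)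
  · have := VectorFourier.integral_fourierIntegral_smul_eq_flip (L := innerₗ V)
      Real.continuous_fourierChar (by exact continuous_inner) hf φ.integrable (μ := volume)
      (ν := volume)
    rw [flip_innerₗ] at this
    simpa [fourier_coe] using! this

/-- Plancherel's theorem: an `L²` function has a distributional Fourier transform in `L²` of the same
norm. -/
theorem MeasureTheory.MemLp.isFourierPair (hf : MemLp f 2) :
    ∃ g, IsFourierPair f g ∧ MemLp g 2 ∧ eLpNorm g 2 volume = eLpNorm f 2 volume := by
  set F := hf.toLp f
  have hmul : ∀ {u : V → ℂ}, MemLp u 2 → ∀ ψ : 𝓢(V, ℂ), Integrable (fun x => u x * ψ x) :=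
    fun hu ψ => hu.integrable_mul (ψ.memLp 2)
  refine ⟨(𝓕 F : Lp ℂ 2 (volume : Measure V)), fun φ => ⟨hmul hf _, hmul (Lp.memLp _) _, ?_⟩, Lp.memLp _, ?_⟩
  · have := DFunLike.congr_fun (Lp.fourier_toTemperedDistribution_eq F) φ
    rw [TemperedDistribution.fourier_apply, Lp.toTemperedDistribution_apply,
      Lp.toTemperedDistribution_apply] at this
    simp only [smul_eq_mul] at this
    simp only [mul_comm _ (φ _)]
    rw [← this]
    refine integral_congr_ae ?_
    filter_upwards [hf.coeFn_toLp] with x hx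
    rw [hx, mul_comm]
  · have := Lp.norm_fourier_eq F
    rw [Lp.norm_def, Lp.norm_def, ENNReal.toReal_eq_toReal_iff' (Lp.eLpNorm_ne_top _)
      (Lp.eLpNorm_ne_top _)] at this
    rw [this]
    exact eLpNorm_congr_ae hf.coeFn_toLp

theorem IsFourierPair.ae_norm_le (h : IsFourierPair f g) (hf : Integrable f) :
    ∀ᵐ ξ, ‖g ξ‖ ≤ ∫ x, ‖f x‖ := by
  filter_upwards [h.ae_unique hf.isFourierPair] with ξ hξ
  rw [hξ]
  exact norm_fourier_le_integral_norm ξ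

theorem eLpNorm_ofReal_eq_lintegral {α : Type*} [MeasurableSpace α] {μ : Measure α} {u : α → ℂ}
    {q : ℝ} (hq : 0 < q) :
    eLpNorm u (ENNReal.ofReal q) μ = (∫⁻ x, ENNReal.ofReal (‖u x‖ ^ q) ∂μ) ^ (1 / q) := by
  rw [eLpNorm_eq_lintegral_rpow_enorm_toReal (by simpa using hq) ENNReal.ofReal_ne_top,
    ENNReal.toReal_ofReal hq.le]
  congr 1
  refine lintegral_congr fun x => ?_
  rw [← ofReal_norm, ENNReal.ofReal_rpow_of_nonneg (norm_nonneg _) hq.le]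

theorem memLp_of_lintegral_rpow_le {α : Type*} [MeasurableSpace α] {μ : Measure α} {u : α → ℂ}
    {q c : ℝ} (hq : 0 < q) (hu : AEStronglyMeasurable u μ) (hc : 0 ≤ c)
    (h : ∫⁻ x, ENNReal.ofReal (‖u x‖ ^ q) ∂μ ≤ ENNReal.ofReal c) :
    MemLp u (ENNReal.ofReal q) μ ∧ (eLpNorm u (ENNReal.ofReal q) μ).toReal ≤ c ^ (1 / q) := by
  have hle : eLpNorm u (ENNReal.ofReal q) μ ≤ ENNReal.ofReal (c ^ (1 / q)) := by
    rw [eLpNorm_ofReal_eq_lintegral hq, ← ENNReal.ofReal_rpow_of_nonneg hc (by positivity)]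
    exact ENNReal.rpow_le_rpow h (by positivity)
  exact ⟨⟨hu, hle.trans_lt ENNReal.ofReal_lt_top⟩,
    ENNReal.toReal_le_of_le_ofReal (by positivity) hle⟩

/-- The constant in the weak-type Hausdorff–Young inequality at the exponent `s`. -/
noncomputable def weakHausdorffYoungConst (s : ℝ) : ℝ :=
  4 * (2 / (2 - s)) * (2 * (s / (s - 1))) ^ ((2 - s) / (s - 1))

theorem weakHausdorffYoungConst_pos {s : ℝ} (hs : 1 < s) (hs' : s < 2) :
    0 < weakHausdorffYoungConst s := by
  have h1 : 0 < s - 1 := by linarith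
  have h2 : 0 < 2 - s := by linarith
  have h3 : 0 < s := by linarith
  unfold weakHausdorffYoungConst
  positivity

/-- Weak-type Hausdorff–Young inequality: for `1 < s < 2` the Fourier transform maps `L^{s,∞}` to
`L^{s',∞}`, where `s' = s / (s - 1)`. To bound the distribution function of `g` at height `t`, cut
`f` at the height `T` for which the `L¹` part of `f` has a Fourier transform of size at most
`t / 2`, and use Plancherel and Chebyshev for the remaining `L²` part. -/
theorem IsFourierPair.hasWeakBound {s K : ℝ} (h : IsFourierPair f g) (hs : 1 < s) (hs' : s < 2)
    (hf : AEStronglyMeasurable f) (hK : 0 < K) (hw : HasWeakBound volume s K f) :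
    HasWeakBound volume (s / (s - 1)) (weakHausdorffYoungConst s * K ^ (1 / (s - 1))) g := by
  intro t ht
  have hs1 : 0 < s - 1 := by linarith
  have hs2 : 0 < 2 - s := by linarith
  have hs0 : 0 < s := by linarith
  set c₁ := s / (s - 1)
  have hc₁ : 0 < c₁ := by positivity
  set B := 2 * c₁ * K / t
  have hB : 0 < B := by positivity
  set T := B ^ (1 / (s - 1))
  have hT : 0 < T := by positivity
  set S : Set V := {x | ‖f x‖ ≤ T}
  have hS : NullMeasurableSet S volume :=
    nullMeasurableSet_le hf.norm.aemeasurable aemeasurable_const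
  have e₁ := hw.lintegral_indicator_compl_le hf hK.le one_pos hs hT
  have e₂ := hw.lintegral_indicator_le hf hK.le two_pos hs' hT
  have hT₁ : c₁ * (K * T ^ (1 - s)) = t / 2 := by
    rw [← Real.rpow_mul hB.le, show 1 / (s - 1) * (1 - s) = -1 by field_simp; ring,
      Real.rpow_neg_one]
    simp only [B]
    field_simp
  have hT₂ : T ^ (2 - s) = B ^ ((2 - s) / (s - 1)) := by
    rw [← Real.rpow_mul hB.le]; congr 1; field_simp
  rw [hT₁] at e₁
  obtain ⟨m₁, n₁⟩ := memLp_of_lintegral_rpow_le one_pos (hf.indicator₀ hS.compl) (by positivity) e₁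
  obtain ⟨m₂, n₂⟩ := memLp_of_lintegral_rpow_le two_pos (hf.indicator₀ hS) (by positivity) e₂
  rw [ENNReal.ofReal_one] at m₁ n₁
  rw [ENNReal.ofReal_ofNat] at m₂ n₂
  have i₁ := memLp_one_iff_integrable.1 m₁
  obtain ⟨g₂, p₂, mg₂, ng₂⟩ := m₂.isFourierPair
  have hsplit : Sᶜ.indicator f + S.indicator f = f := by
    rw [add_comm]; exact Set.indicator_self_add_compl S f
  have hsum := i₁.isFourierPair.add p₂
  rw [hsplit] at hsum
  have hint : ∫ x, ‖Sᶜ.indicator f x‖ ≤ t / 2 := by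
    rw [integral_norm_eq_lintegral_enorm i₁.1, ← eLpNorm_one_eq_lintegral_enorm]
    simpa using n₁
  have hsub : volume {ξ | t < ‖g ξ‖} ≤ volume {ξ | t / 2 < ‖g₂ ξ‖} := by
    refine measure_mono_ae ?_
    filter_upwards [h.ae_unique hsum] with ξ hξ (hlt : t < ‖g ξ‖)
    change t / 2 < ‖g₂ ξ‖
    rw [hξ] at hlt
    have a1 := norm_add_le (𝓕 (Sᶜ.indicator f) ξ) (g₂ ξ)
    have a2 := (norm_fourier_le_integral_norm (f := Sᶜ.indicator f) ξ).trans hint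
    simp only [Pi.add_apply] at hlt
    linarith
  have hcheb := MemLp.hasWeakBound (f := g₂) (μ := volume) two_pos
    (by rwa [ENNReal.ofReal_ofNat]) (t / 2) (half_pos ht)
  refine hsub.trans (hcheb.trans (ENNReal.ofReal_le_ofReal ?_))
  rw [ENNReal.ofReal_ofNat, ng₂]
  have n₂' : (eLpNorm (S.indicator f) 2 volume).toReal ^ (2 : ℝ) ≤
      2 / (2 - s) * (K * T ^ (2 - s)) := by
    refine (Real.rpow_le_rpow ENNReal.toReal_nonneg n₂ two_pos.le).trans (le_of_eq ?_)
    rw [← Real.rpow_mul (by positivity)]; norm_num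
  refine (mul_le_mul_of_nonneg_right n₂' (by positivity)).trans (le_of_eq ?_)
  have hB' : B ^ ((2 - s) / (s - 1)) =
      (2 * c₁) ^ ((2 - s) / (s - 1)) * K ^ ((2 - s) / (s - 1)) * t ^ (-((2 - s) / (s - 1))) := by
    simp only [B]
    rw [Real.div_rpow (by positivity) ht.le, Real.mul_rpow (by positivity) hK.le,
      Real.rpow_neg ht.le]
    rfl
  have ht2 : (t / 2) ^ (-2 : ℝ) = 4 * t ^ (-2 : ℝ) := by
    rw [Real.div_rpow ht.le two_pos.le, Real.rpow_neg two_pos.le]; norm_num; ring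
  have hKe : K ^ (1 / (s - 1)) = K * K ^ ((2 - s) / (s - 1)) := by
    rw [← Real.rpow_one_add' hK.le (by positivity)]; congr 1; field_simp; ring
  have hte : t ^ (-(s / (s - 1))) = t ^ (-((2 - s) / (s - 1))) * t ^ (-2 : ℝ) := by
    rw [← Real.rpow_add ht]; congr 1; field_simp; ring
  rw [hT₂, hB', ht2, hKe, hte, weakHausdorffYoungConst]
  ring

end FourierPair

section Normalisation

open FourierTransform

variable {n : ℕ} {f g : EuclideanSpace ℝ (Fin n) → ℂ}

/-- Passing from the normalisation `∫ e^{-i x·ξ} f(x) dx` to the unitary one dilates the Fourier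
transform by `2π`. -/
theorem IsFourierTransform.isFourierPair (h : IsFourierTransform f g) :
    IsFourierPair f (fun ξ => g ((2 * Real.pi) • ξ)) := by
  have hpi : (2 * Real.pi) ≠ 0 := by positivity
  intro φ
  let L : EuclideanSpace ℝ (Fin n) ≃L[ℝ] EuclideanSpace ℝ (Fin n) :=
    ContinuousLinearEquiv.smulLeft (Units.mk0 (2 * Real.pi)⁻¹ (inv_ne_zero hpi))
  let ψ : 𝓢(EuclideanSpace ℝ (Fin n), ℂ) := SchwartzMap.compCLMOfContinuousLinearEquiv ℂ L φ
  have hψ : ∀ x, ψ ((2 * Real.pi) • x) = φ x := fun x => by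
    change φ ((2 * Real.pi)⁻¹ • (2 * Real.pi) • x) = φ x
    rw [inv_smul_smul₀ hpi]
  have hpos : (0 : ℝ) < |((2 * Real.pi) ^ n)⁻¹| := by positivity
  have hhat : ∀ x, 𝓕 φ x = |((2 * Real.pi) ^ n)⁻¹| • fourierIntegralHat ψ x := fun x => by
    have := Measure.integral_comp_smul (μ := (volume : Measure (EuclideanSpace ℝ (Fin n))))
      (fun y => Complex.exp (-(Complex.I * ((inner ℝ y x : ℝ) : ℂ))) * ψ y) (2 * Real.pi)
    rw [finrank_euclideanSpace_fin] at this
    rw [fourierIntegralHat, ← this, fourier_coe, Real.fourier_eq']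
    refine integral_congr_ae (Filter.Eventually.of_forall fun y => ?_)
    simp only [hψ, smul_eq_mul, real_inner_smul_left]
    push_cast
    ring_nf
  obtain ⟨h1, h2, h3⟩ := h ψ
  refine ⟨?_, ?_, ?_⟩
  · simp only [hhat, mul_smul_comm]
    exact h1.smul |((2 * Real.pi) ^ n)⁻¹|
  · have := (integrable_comp_smul_iff volume _ hpi).2 h2
    simpa only [hψ] using this
  · have := Measure.integral_comp_smul (μ := (volume : Measure (EuclideanSpace ℝ (Fin n))))
      (fun y => g y * ψ y) (2 * Real.pi)
    rw [finrank_euclideanSpace_fin] at this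
    simp only [hψ] at this
    rw [this, h3, ← integral_smul]
    simp only [hhat, mul_smul_comm]

/-- An expanding dilation only decreases the distribution function. -/
theorem HasWeakBound.comp_dilation {r K c : ℝ} (hc : 1 ≤ c) (h : HasWeakBound volume r K g) :
    HasWeakBound volume r K (fun ξ => g (c • ξ)) := by
  intro t ht
  have := Measure.addHaar_preimage_smul (volume : Measure (EuclideanSpace ℝ (Fin n)))
    (r := c) (by positivity) {x | t < ‖g x‖}
  change volume ((c • ·) ⁻¹' {x | t < ‖g x‖}) ≤ _
  rw [this]
  refine le_trans (mul_le_of_le_one_left' ?_) (h t ht)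
  rw [ENNReal.ofReal_le_one, abs_of_pos (by positivity)]
  exact inv_le_one_of_one_le₀ (one_le_pow₀ hc)

theorem eLpNorm_comp_dilation {c : ℝ} (hc : 0 < c) (q : ℝ≥0∞) (hg : AEStronglyMeasurable g) :
    AEStronglyMeasurable (fun ξ => g (c • ξ)) ∧ eLpNorm (fun ξ => g (c • ξ)) q volume =
      ENNReal.ofReal (c ^ n)⁻¹ ^ (1 / q).toReal * eLpNorm g q volume := by
  have hmap := Measure.map_addHaar_smul (volume : Measure (EuclideanSpace ℝ (Fin n))) hc.ne'
  rw [finrank_euclideanSpace_fin, abs_of_pos (by positivity)] at hmap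
  have hm : AEMeasurable (fun ξ : EuclideanSpace ℝ (Fin n) => c • ξ) volume :=
    (measurable_const_smul c).aemeasurable
  have hg' : AEStronglyMeasurable g (Measure.map (fun ξ => c • ξ) volume) := by
    rw [hmap]; exact hg.smul_measure _
  refine ⟨hg'.comp_aemeasurable hm, ?_⟩
  have := eLpNorm_map_measure (p := q) hg' hm
  rw [hmap, eLpNorm_smul_measure_of_ne_zero (by simp; positivity)] at this
  exact this.symm

end Normalisation

/-! ### The weighted norm controls a weak norm at the critical exponent -/

theorem criticalExponent_eq_ofReal {n : ℕ} {θ : ℝ} {p : ℝ≥0∞} (hθ : 0 < θ) (hp : 0 < p) :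
    criticalExponent n p θ = ENNReal.ofReal (n / (n * (p⁻¹).toReal + θ)) := by
  have hp' : p⁻¹ ≠ ∞ := by simpa using hp.ne'
  rw [criticalExponent, div_eq_mul_inv (n : ℝ≥0∞) p,
    ENNReal.ofReal_div_of_pos (by positivity), ENNReal.ofReal_add (by positivity) hθ.le,
    ENNReal.ofReal_mul (by positivity), ENNReal.ofReal_toReal hp', ENNReal.ofReal_natCast]

section Weighted

variable {n : ℕ} {θ A : ℝ} {p : ℝ≥0∞} {f : EuclideanSpace ℝ (Fin n) → ℂ}

theorem aestronglyMeasurable_rpow_norm_mul (hθ : 0 < θ) (hf : AEStronglyMeasurable f) :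
    AEStronglyMeasurable (fun x => ((‖x‖ ^ θ : ℝ) : ℂ) * f x) := by
  refine AEStronglyMeasurable.mul (Continuous.aestronglyMeasurable ?_) hf
  exact Complex.continuous_ofReal.comp (continuous_norm.rpow_const fun _ => Or.inr hθ.le)

theorem ae_eq_zero_of_weightedLpNorm_eq_zero (hn : 0 < n) (hθ : 0 < θ) (hp : 0 < p)
    (hf : AEStronglyMeasurable f) (h : weightedLpNorm θ p f = 0) : f =ᵐ[volume] 0 := by
  have : Nonempty (Fin n) := ⟨⟨0, hn⟩⟩
  rw [weightedLpNorm, eLpNorm_eq_zero_iff (aestronglyMeasurable_rpow_norm_mul hθ hf) hp.ne'] at h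
  have h0 : ∀ᵐ x : EuclideanSpace ℝ (Fin n), x ≠ 0 := by
    rw [ae_iff]; simp
  filter_upwards [h, h0] with x hx hx0
  have : ((‖x‖ ^ θ : ℝ) : ℂ) ≠ 0 := by
    rw [Complex.ofReal_ne_zero]
    exact (Real.rpow_pos_of_pos (norm_pos_iff.2 hx0) _).ne'
  simpa [this] using hx

/-- If `|x|^θ f ∈ L^p`, then `f` is in weak `L^r` for the critical exponent `1/r = 1/p + θ/n`.
A point where `|f| > t` lies in the ball of radius `R` or satisfies `|x|^θ |f| > t R^θ`; the two
alternatives balance at `R^n = (A / t)^r`. -/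
theorem hasWeakBound_of_weightedLpNorm_le (hn : 0 < n) (hθ : 0 < θ) (hp : 0 < p)
    (hf : AEStronglyMeasurable f) (hA : 0 < A) (h : weightedLpNorm θ p f ≤ ENNReal.ofReal A) :
    HasWeakBound volume (n / (n * (p⁻¹).toReal + θ))
      (((volume (Metric.ball (0 : EuclideanSpace ℝ (Fin n)) 1)).toReal + 1) *
        A ^ (n / (n * (p⁻¹).toReal + θ))) f := by
  intro t ht
  have hn' : (0 : ℝ) < n := by exact_mod_cast hn
  set ρ : ℝ := n / (n * (p⁻¹).toReal + θ) with hρdef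
  have hden : 0 < n * (p⁻¹).toReal + θ := by positivity
  have hρ : 0 < ρ := by positivity
  have hAt : 0 < A / t := by positivity
  set R := (A / t) ^ (ρ / n)
  have hR : 0 < R := by positivity
  have hRn : R ^ n = (A / t) ^ ρ := by
    rw [← Real.rpow_natCast, ← Real.rpow_mul hAt.le]; congr 1; field_simp
  set u : EuclideanSpace ℝ (Fin n) → ℂ := fun x => ((‖x‖ ^ θ : ℝ) : ℂ) * f x with hu
  have hum : AEStronglyMeasurable u := aestronglyMeasurable_rpow_norm_mul hθ hf
  have hnorm : ∀ x, ‖u x‖ = ‖x‖ ^ θ * ‖f x‖ := fun x => by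
    rw [hu]; simp [abs_of_nonneg (Real.rpow_nonneg (norm_nonneg x) θ)]
  have hsub : {x | t < ‖f x‖} ⊆ Metric.closedBall 0 R ∪ {x | t * R ^ θ < ‖u x‖} := by
    intro x (hx : t < ‖f x‖)
    by_cases hxR : ‖x‖ ≤ R
    · left; simpa using hxR
    · right
      change t * R ^ θ < ‖u x‖
      rw [hnorm, mul_comm]
      push Not at hxR
      have h1 := Real.rpow_lt_rpow hR.le hxR hθ
      have h2 : 0 < R ^ θ := by positivity
      nlinarith [norm_nonneg (f x)]
  have hball : volume (Metric.closedBall (0 : EuclideanSpace ℝ (Fin n)) R) =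
      ENNReal.ofReal ((volume (Metric.ball (0 : EuclideanSpace ℝ (Fin n)) 1)).toReal *
        (A / t) ^ ρ) := by
    rw [Measure.addHaar_closedBall _ _ hR.le, finrank_euclideanSpace_fin, hRn, mul_comm,
      ENNReal.ofReal_mul ENNReal.toReal_nonneg, ENNReal.ofReal_toReal measure_ball_lt_top.ne]
  have htail : volume {x | t * R ^ θ < ‖u x‖} ≤ ENNReal.ofReal ((A / t) ^ ρ) := by
    by_cases hpt : p = ∞
    · subst hpt
      have hRθ : t * R ^ θ = A := by
        rw [← Real.rpow_mul hAt.le, hρdef]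
        have : (n : ℝ) / (n * ((∞ : ℝ≥0∞)⁻¹).toReal + θ) / n * θ = 1 := by
          simp; field_simp
        rw [this, Real.rpow_one]; field_simp
      have h0 : volume {x | t * R ^ θ < ‖u x‖} = 0 := by
        have : ∀ᵐ x, ‖u x‖ ≤ A := by
          rw [weightedLpNorm, eLpNorm_exponent_top] at h
          filter_upwards [ae_le_eLpNormEssSup (f := u) (μ := volume)] with x hx
          have := hx.trans h
          rw [← ofReal_norm] at this
          exact (ENNReal.ofReal_le_ofReal_iff hA.le).1 this
        rw [hRθ]
        simpa [ae_iff] using this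
      rw [h0]; exact zero_le
    · have hP : 0 < p.toReal := ENNReal.toReal_pos hp.ne' hpt
      have hpe : ENNReal.ofReal p.toReal = p := ENNReal.ofReal_toReal hpt
      have hmem : MemLp u (ENNReal.ofReal p.toReal) volume := by
        rw [hpe]; exact ⟨hum, lt_of_le_of_lt h ENNReal.ofReal_lt_top⟩
      refine ((MemLp.hasWeakBound hP hmem) (t * R ^ θ) (by positivity)).trans
        (ENNReal.ofReal_le_ofReal ?_)
      rw [hpe]
      have hle : (eLpNorm u p volume).toReal ^ p.toReal ≤ A ^ p.toReal :=
        Real.rpow_le_rpow ENNReal.toReal_nonneg (ENNReal.toReal_le_of_le_ofReal hA.le h) hP.le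
      refine (mul_le_mul_of_nonneg_right hle (by positivity)).trans (le_of_eq ?_)
      have hexp : ρ = p.toReal + ρ / n * θ * (-p.toReal) := by
        rw [hρdef, ENNReal.toReal_inv]
        field_simp
        ring
      have e1 : (A / t) ^ ρ = (A / t) ^ p.toReal * (A / t) ^ (ρ / n * θ * (-p.toReal)) := by
        rw [← Real.rpow_add hAt, ← hexp]
      rw [e1, Real.mul_rpow ht.le (by positivity), ← Real.rpow_mul hAt.le,
        ← Real.rpow_mul hAt.le, Real.div_rpow hA.le ht.le p.toReal, Real.rpow_neg ht.le]
      ring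
  refine (measure_mono hsub).trans ((measure_union_le _ _).trans ?_)
  rw [hball]
  refine (add_le_add_right htail _).trans (le_of_eq ?_)
  rw [← ENNReal.ofReal_add (by positivity) (by positivity), Real.div_rpow hA.le ht.le,
    Real.rpow_neg ht.le]
  congr 1
  ring

end Weighted

/-! ### Bounded and integrable functions with a weak bound -/

section Bounded

variable {α : Type*} [MeasurableSpace α] {μ : Measure α} {f : α → ℂ} {r q K F : ℝ}

theorem HasWeakBound.lintegral_rpow_le_of_ae_bound (h : HasWeakBound μ r K f)
    (hf : AEStronglyMeasurable f μ) (hK : 0 ≤ K) (hq : 0 < q) (hrq : r < q) (hF : 0 < F)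
    (hb : ∀ᵐ x ∂μ, ‖f x‖ ≤ F) :
    ∫⁻ x, ENNReal.ofReal (‖f x‖ ^ q) ∂μ ≤ ENNReal.ofReal (q / (q - r) * (K * F ^ (q - r))) := by
  refine le_trans (le_of_eq (lintegral_congr_ae ?_))
    (h.lintegral_indicator_le hf hK hq hrq hF)
  filter_upwards [hb] with x hx
  rw [Set.indicator_of_mem (by exact hx)]

/-- A function in weak `L^r` with `r < 1` that also lies in some `L^s`, `s ≥ 1`, is integrable. -/
theorem HasWeakBound.integrable_of_memLp (h : HasWeakBound μ r K f) (hK : 0 ≤ K) (hr : r < 1)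
    {s : ℝ≥0∞} (hs : 1 ≤ s) (hf : MemLp f s μ) : Integrable f μ := by
  rw [← memLp_one_iff_integrable, ← ENNReal.ofReal_one]
  by_cases hst : s = ∞
  · subst hst
    have hb : ∀ᵐ x ∂μ, ‖f x‖ ≤ (eLpNormEssSup f μ).toReal + 1 := by
      filter_upwards [ae_le_eLpNormEssSup (f := f) (μ := μ)] with x hx
      have hfin : eLpNormEssSup f μ ≠ ∞ := by
        rw [← eLpNorm_exponent_top]; exact hf.2.ne
      have := ENNReal.toReal_mono hfin hx
      rw [toReal_enorm] at this
      linarith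
    have hpos : 0 < (eLpNormEssSup f μ).toReal + 1 := by positivity
    have h1r : 0 ≤ 1 / (1 - r) := div_nonneg zero_le_one (by linarith)
    exact (memLp_of_lintegral_rpow_le one_pos hf.1 (by positivity)
      (h.lintegral_rpow_le_of_ae_bound hf.1 hK one_pos hr hpos hb)).1
  rcases hs.eq_or_lt with rfl | hs
  · rwa [ENNReal.ofReal_one]
  have hs1 : 1 < s.toReal := by
    simpa using (ENNReal.toReal_lt_toReal ENNReal.one_ne_top hst).2 hs
  have hw := MemLp.hasWeakBound (f := f) (μ := μ) (q := s.toReal) (by linarith)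
    (by rwa [ENNReal.ofReal_toReal hst])
  refine (memLp_of_lintegral_rpow_le one_pos hf.1 ?_
    (h.lintegral_rpow_le hw hf.1 hK (by positivity) one_pos hr hs1 one_pos)).1
  have h1r : 0 ≤ 1 / (1 - r) := div_nonneg zero_le_one (by linarith)
  have h2r : 0 ≤ s.toReal / (s.toReal - 1) := div_nonneg (by linarith) (by linarith)
  positivity

end Bounded

section Reflection

variable {V : Type*} [NormedAddCommGroup V] [InnerProductSpace ℝ V] [FiniteDimensional ℝ V]
  [MeasurableSpace V] [BorelSpace V] {f g : V → ℂ}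

theorem ae_comp_neg_iff {P : V → Prop} : (∀ᵐ x : V, P (-x)) ↔ ∀ᵐ x : V, P x := by
  have key : ∀ {Q : V → Prop}, (∀ᵐ x : V, Q x) → ∀ᵐ x : V, Q (-x) := fun h =>
    (Measure.measurePreserving_neg (volume : Measure V)).quasiMeasurePreserving.ae h
  exact ⟨fun h => by simpa using key h, key⟩

theorem HasWeakBound.comp_neg {r K : ℝ} (h : HasWeakBound volume r K fun x => f (-x)) :
    HasWeakBound volume r K f := by
  intro t ht
  have h1 := Measure.measure_preimage_neg (volume : Measure V) {x | t < ‖f x‖}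
  rw [← h1]
  exact h t ht

theorem IsFourierPair.ae_norm_le' (h : IsFourierPair f g) (hg : Integrable g) :
    ∀ᵐ x, ‖f x‖ ≤ ∫ ξ, ‖g ξ‖ :=
  ae_comp_neg_iff.1 (h.symm.ae_norm_le hg)

/-- The Fourier transform is injective on tempered functions. -/
theorem IsFourierPair.not_ae_eq_zero (h : IsFourierPair f g) (hf : ¬ f =ᵐ[volume] 0) :
    ¬ g =ᵐ[volume] 0 := by
  intro hg
  have hi : Integrable g := (integrable_zero V ℂ volume).congr hg.symm
  refine hf ?_
  filter_upwards [h.ae_norm_le' hi] with x hx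
  have h0 : ∫ ξ, ‖g ξ‖ = 0 := by
    rw [integral_eq_zero_of_ae]
    filter_upwards [hg] with ξ hξ
    simp [hξ]
  rw [h0] at hx
  simpa using hx

end Reflection

/-! ### The uncertainty principle for weak norms -/

/-- A self-improving inequality `P ≤ c P^ε` with `ε < 1` bounds `P`. -/
theorem le_rpow_of_le_mul_rpow {P c ε : ℝ} (hP : 0 < P) (hε : ε < 1) (h : P ≤ c * P ^ ε) :
    P ≤ c ^ (1 / (1 - ε)) := by
  have h1 : 0 < 1 - ε := by linarith
  have h2 : P ^ (1 - ε) ≤ c := by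
    rw [Real.rpow_sub hP, Real.rpow_one, div_le_iff₀ (by positivity)]
    exact h
  calc P = (P ^ (1 - ε)) ^ (1 / (1 - ε)) := by
        rw [← Real.rpow_mul hP.le, mul_one_div_cancel h1.ne', Real.rpow_one]
    _ ≤ _ := Real.rpow_le_rpow (by positivity) h2 (by positivity)

section Core

variable {V : Type*} [NormedAddCommGroup V] [InnerProductSpace ℝ V] [FiniteDimensional ℝ V]
  [MeasurableSpace V] [BorelSpace V]

/-- The case of a critical exponent `ρ < 1`. Here `f` and `g` are integrable, hence bounded, and
`‖g‖_∞ ≤ ‖f‖_1 ≲ ‖f‖_{ρ,∞}^ρ ‖f‖_∞^{1-ρ}` together with its mirror image bounds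
`‖f‖_∞ ‖g‖_∞`. -/
theorem IsFourierPair.exists_bound_of_lt_one {ρ : ℝ} {q : ℝ≥0∞} (hρ : 0 < ρ) (hρ1 : ρ < 1)
    (hq : ENNReal.ofReal ρ < q) :
    ∃ C : ℝ, 0 < C ∧ ∀ (f g : V → ℂ) (K L : ℝ), 0 < K → 0 < L → IsFourierPair f g →
      HasWeakBound volume ρ K f → HasWeakBound volume ρ L g →
      AEStronglyMeasurable g → (∃ r : ℝ≥0∞, 1 ≤ r ∧ MemLp f r) → ¬ f =ᵐ[volume] 0 →
      eLpNorm f q volume * eLpNorm g q volume ≤ ENNReal.ofReal (C * (K * L) ^ (1 / ρ)) := by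
  set c := 1 / (1 - ρ)
  have h1ρ : 0 < 1 - ρ := by linarith
  have hc : 0 < c := by positivity
  -- the bound on `‖f‖_∞ ‖g‖_∞`, and the integrability that makes these norms finite
  have key : ∀ (f g : V → ℂ) (K L : ℝ), 0 < K → 0 < L → IsFourierPair f g →
      HasWeakBound volume ρ K f → HasWeakBound volume ρ L g →
      AEStronglyMeasurable g → (∃ r : ℝ≥0∞, 1 ≤ r ∧ MemLp f r) → ¬ f =ᵐ[volume] 0 →
      ∃ F G : ℝ, 0 < F ∧ 0 < G ∧ eLpNorm f ∞ volume = ENNReal.ofReal F ∧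
        eLpNorm g ∞ volume = ENNReal.ofReal G ∧ (∀ᵐ x, ‖f x‖ ≤ F) ∧ (∀ᵐ x, ‖g x‖ ≤ G) ∧
        F * G ≤ (c ^ 2 * (K * L)) ^ (1 / ρ) := by
    intro f g K L hK hL h hf hg hgm ⟨r, hr, hfr⟩ hf0
    have hg0 := h.not_ae_eq_zero hf0
    have fi := hf.integrable_of_memLp hK.le hρ1 hr hfr
    have gb := h.ae_norm_le fi
    have gtop : MemLp g ∞ := memLp_top_of_bound hgm _ gb
    have gi := hg.integrable_of_memLp hL.le hρ1 (by simp) gtop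
    have fb := h.ae_norm_le' gi
    have ftop : MemLp f ∞ := memLp_top_of_bound hfr.1 _ fb
    have pos : ∀ {u : V → ℂ}, MemLp u ∞ → ¬ u =ᵐ[volume] 0 →
        0 < (eLpNorm u ∞ volume).toReal := fun hu h0 =>
      ENNReal.toReal_pos (fun h => h0 ((eLpNorm_eq_zero_iff hu.1 (by simp)).1 h)) hu.2.ne
    have bound : ∀ {u : V → ℂ}, MemLp u ∞ → ∀ᵐ x, ‖u x‖ ≤ (eLpNorm u ∞ volume).toReal := by
      intro u hu
      filter_upwards [ae_le_eLpNormEssSup (f := u) (μ := volume)] with x hx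
      rw [← eLpNorm_exponent_top] at hx
      simpa using ENNReal.toReal_mono hu.2.ne hx
    have step : ∀ {u v : V → ℂ} {M : ℝ}, 0 < M → HasWeakBound volume ρ M u → MemLp u ∞ →
        Integrable u → ¬ u =ᵐ[volume] 0 → (∀ᵐ x, ‖v x‖ ≤ ∫ y, ‖u y‖) →
        (eLpNorm v ∞ volume).toReal ≤ c * (M * (eLpNorm u ∞ volume).toReal ^ (1 - ρ)) := by
      intro u v M hM hw hu hi h0 hv
      have hl := hw.lintegral_rpow_le_of_ae_bound hu.1 hM.le one_pos hρ1 (pos hu h0) (bound hu)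
      have h1 := (memLp_of_lintegral_rpow_le one_pos hu.1 (by positivity) hl).2
      rw [ENNReal.ofReal_one, eLpNorm_one_eq_lintegral_enorm,
        ← integral_norm_eq_lintegral_enorm hu.1, div_one, Real.rpow_one] at h1
      refine le_trans ?_ h1
      refine ENNReal.toReal_le_of_le_ofReal (integral_nonneg fun _ => norm_nonneg _) ?_
      rw [eLpNorm_exponent_top]
      exact eLpNormEssSup_le_of_ae_bound hv
    have sG := step hK hf ftop fi hf0 gb
    have sF := step hL hg gtop gi hg0 fb
    have pF := pos ftop hf0
    have pG := pos gtop hg0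
    refine ⟨_, _, pF, pG, (ENNReal.ofReal_toReal ftop.2.ne).symm,
      (ENNReal.ofReal_toReal gtop.2.ne).symm, bound ftop, bound gtop, ?_⟩
    set F := (eLpNorm f ∞ volume).toReal
    set G := (eLpNorm g ∞ volume).toReal
    have := le_rpow_of_le_mul_rpow (P := F * G) (c := c ^ 2 * (K * L)) (ε := 1 - ρ)
      (by positivity) (by linarith) (by
        refine (mul_le_mul sF sG pG.le (by positivity)).trans (le_of_eq ?_)
        rw [Real.mul_rpow pF.le pG.le]
        ring)
    simpa using this
  by_cases hqt : q = ∞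
  · subst hqt
    refine ⟨(c ^ 2) ^ (1 / ρ), by positivity, fun f g K L hK hL h hf hg hgm hr hf0 => ?_⟩
    obtain ⟨F, G, hF, hG, eF, eG, -, -, hFG⟩ := key f g K L hK hL h hf hg hgm hr hf0
    rw [eF, eG, ← ENNReal.ofReal_mul hF.le, ← Real.mul_rpow (by positivity) (by positivity)]
    exact ENNReal.ofReal_le_ofReal hFG
  obtain ⟨Q, hQ, rfl⟩ : ∃ Q : ℝ, ρ < Q ∧ q = ENNReal.ofReal Q :=
    ⟨q.toReal, (ENNReal.ofReal_lt_iff_lt_toReal hρ.le hqt).1 hq, (ENNReal.ofReal_toReal hqt).symm⟩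
  have hQ0 : 0 < Q := hρ.trans hQ
  have hQρ : 0 < Q - ρ := by linarith
  set d := Q / (Q - ρ)
  have hd : 0 < d := by positivity
  refine ⟨(d ^ 2 * ((c ^ 2) ^ ((Q - ρ) / ρ))) ^ (1 / Q), by positivity,
    fun f g K L hK hL h hf hg hgm hr hf0 => ?_⟩
  obtain ⟨F, G, hF, hG, -, -, bF, bG, hFG⟩ := key f g K L hK hL h hf hg hgm hr hf0
  have hfm : AEStronglyMeasurable f := by obtain ⟨r, -, hr⟩ := hr; exact hr.1
  obtain ⟨mf, lf⟩ := memLp_of_lintegral_rpow_le hQ0 hfm (by positivity)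
    (hf.lintegral_rpow_le_of_ae_bound hfm hK.le hQ0 hQ hF bF)
  obtain ⟨mg, lg⟩ := memLp_of_lintegral_rpow_le hQ0 hgm (by positivity)
    (hg.lintegral_rpow_le_of_ae_bound hgm hL.le hQ0 hQ hG bG)
  rw [← ENNReal.ofReal_toReal mf.2.ne, ← ENNReal.ofReal_toReal mg.2.ne,
    ← ENNReal.ofReal_mul ENNReal.toReal_nonneg]
  refine ENNReal.ofReal_le_ofReal
    ((mul_le_mul lf lg ENNReal.toReal_nonneg (by positivity)).trans ?_)
  rw [← Real.mul_rpow (by positivity) (by positivity)]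
  have hX : 0 < K * L := by positivity
  have e1 : (K * L) ^ (1 / ρ) = ((K * L) ^ (Q / ρ)) ^ (1 / Q) := by
    rw [← Real.rpow_mul hX.le]; congr 1; field_simp
  rw [e1, ← Real.mul_rpow (by positivity) (by positivity)]
  refine Real.rpow_le_rpow (by positivity) ?_ (by positivity)
  have e2 : (K * L) ^ (Q / ρ) = (K * L) * (K * L) ^ ((Q - ρ) / ρ) := by
    rw [← Real.rpow_one_add' hX.le (by positivity)]; congr 1; field_simp; ring
  calc d * (K * F ^ (Q - ρ)) * (d * (L * G ^ (Q - ρ)))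
      = d ^ 2 * (K * L) * (F * G) ^ (Q - ρ) := by rw [Real.mul_rpow hF.le hG.le]; ring
    _ ≤ d ^ 2 * (K * L) * ((c ^ 2 * (K * L)) ^ (1 / ρ)) ^ (Q - ρ) := by gcongr
    _ = _ := by
      rw [e2, ← Real.rpow_mul (by positivity), one_div_mul_eq_div,
        Real.mul_rpow (by positivity) hX.le]
      ring

/-- The bootstrap for finite exponents, used for a critical exponent `ρ ≥ 1`. With `s' = s / (s - 1)`
the conjugate exponent, weak-type Hausdorff–Young and interpolation between `ρ` and `s'` give
`‖g‖_{s',∞} ≲ ‖f‖_{s,∞} ≤ ‖f‖_{ρ,∞}^α ‖f‖_{s',∞}^{1-α}`. The mirror image of this bounds the product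
of the weak-`L^{s'}` norms, and `L^q` lies between weak `L^ρ` and weak `L^{s'}`. -/
theorem IsFourierPair.exists_bound_of_lt_two {ρ s Q : ℝ} (hρ : 0 < ρ) (hρs : ρ < s) (hs1 : 1 < s)
    (hs2 : s < 2) (hsQ : s < Q) (hQs : Q < s / (s - 1)) :
    ∃ C : ℝ, 0 < C ∧ ∀ (f g : V → ℂ) (K L : ℝ), 0 < K → 0 < L → IsFourierPair f g →
      HasWeakBound volume ρ K f → HasWeakBound volume ρ L g →
      MemLp f (ENNReal.ofReal Q) → MemLp g (ENNReal.ofReal Q) → ¬ f =ᵐ[volume] 0 →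
      eLpNorm f (ENNReal.ofReal Q) volume * eLpNorm g (ENNReal.ofReal Q) volume ≤
        ENNReal.ofReal (C * (K * L) ^ (1 / ρ)) := by
  have hs0 : 0 < s - 1 := by linarith
  have h2s : 0 < 2 - s := by linarith
  have hsp : 0 < s := by linarith
  have hQ : 0 < Q := by linarith
  set σ := s / (s - 1) with hσ
  have hρσ : 0 < σ - ρ := by linarith
  have hQρ : 0 < Q - ρ := by linarith
  have hσQ : 0 < σ - Q := by linarith
  have hσ0 : 0 < σ := by linarith
  set α := (σ - s) / (σ - ρ) with hα
  have hα0 : 0 < α := div_pos (by linarith) hρσ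
  have hα1 : α < 1 := by rw [hα, div_lt_one hρσ]; linarith
  have h1α : 1 - α = (s - ρ) / (σ - ρ) := by rw [hα]; field_simp; ring
  have hconv : α * ρ + (1 - α) * σ = s := by rw [h1α, hα]; field_simp; ring
  set β := 1 / (s - 1) with hβ
  have hβ0 : 0 < β := by positivity
  set H := weakHausdorffYoungConst s
  have hH : 0 < H := weakHausdorffYoungConst_pos hs1 hs2
  set ε := (1 - α) * β with hε
  have hσs : σ * (s - 1) = s := by rw [hσ]; field_simp
  have h1ε : (1 - ε) * ((σ - ρ) * (s - 1)) = ρ * (2 - s) := by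
    rw [hε, h1α, hβ]; field_simp; linear_combination hσs
  have hε1 : ε < 1 := by
    have : 0 < (1 - ε) * ((σ - ρ) * (s - 1)) := by rw [h1ε]; positivity
    have := (pos_iff_pos_of_mul_pos this).2 (by positivity)
    linarith
  have hαβ : α * β / (1 - ε) = σ / ρ := by
    have h1 : 1 - ε ≠ 0 := by linarith
    have h2 : 1 - ε = ρ * (2 - s) / ((σ - ρ) * (s - 1)) := by
      rw [← h1ε]; field_simp
    rw [h2, hα, hβ]
    field_simp
    linear_combination hσs
  have h1ε0 : 0 < 1 - ε := by linarith
  have key : ∀ (f g : V → ℂ) (K L : ℝ), 0 < K → 0 < L → IsFourierPair f g →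
      HasWeakBound volume ρ K f → HasWeakBound volume ρ L g →
      MemLp f (ENNReal.ofReal Q) → MemLp g (ENNReal.ofReal Q) → ¬ f =ᵐ[volume] 0 →
      ∃ M N : ℝ, 0 < M ∧ 0 < N ∧ HasWeakBound volume σ M f ∧ HasWeakBound volume σ N g ∧
        M * N ≤ (H ^ 2) ^ (1 / (1 - ε)) * (K * L) ^ (σ / ρ) := by
    intro f g K L hK hL h hf hg mf mg hf0
    have hg0 := h.not_ae_eq_zero hf0
    -- the qualitative step: the weak-`L^σ` constants are finite
    have finite : ∀ {u v : V → ℂ} {M : ℝ}, 0 < M → HasWeakBound volume ρ M u →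
        MemLp u (ENNReal.ofReal Q) → ¬ u =ᵐ[volume] 0 → IsFourierPair u v →
        ∃ M', 0 ≤ M' ∧ HasWeakBound volume σ M' v := by
      intro u v M hM hw hu hu0 huv
      have hQw := MemLp.hasWeakBound hQ hu
      have := hw.interpolate (θ := (Q - s) / (Q - ρ)) hQw hM.le (by positivity)
        (div_nonneg (by linarith) hQρ.le) (by rw [div_le_one hQρ]; linarith)
      rw [show (Q - s) / (Q - ρ) * ρ + (1 - (Q - s) / (Q - ρ)) * Q = s by field_simp; ring] at this
      have hpos := this.pos_of_not_ae_eq_zero hu0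
      exact ⟨_, by positivity, huv.hasWeakBound hs1 hs2 hu.1 hpos this⟩
    obtain ⟨N', hN', wN'⟩ := finite hK hf mf hf0 h
    obtain ⟨M', hM', wM'⟩ := finite hL hg mg hg0 h.symm
    obtain ⟨N, -, wN, minN⟩ := wN'.exists_least hN'
    obtain ⟨M, -, wM, minM⟩ := wM'.comp_neg.exists_least hM'
    have pN := wN.pos_of_not_ae_eq_zero hg0
    have pM := wM.pos_of_not_ae_eq_zero hf0
    have improve : ∀ {u v : V → ℂ} {A B : ℝ}, 0 < A → 0 < B → HasWeakBound volume ρ A u →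
        HasWeakBound volume σ B u → AEStronglyMeasurable u → IsFourierPair u v →
        HasWeakBound volume σ (H * (A ^ α * B ^ (1 - α)) ^ β) v := by
      intro u v A B hA hB wA wB hu huv
      have := wA.interpolate wB hA.le hB.le hα0.le hα1.le
      rw [hconv] at this
      exact huv.hasWeakBound hs1 hs2 hu (by positivity) this
    have lN := minN _ (by positivity) (improve hK pM hf wM mf.1 h)
    have lM := minM _ (by positivity) (improve hL pN hg wN mg.1 h.symm).comp_neg
    refine ⟨M, N, pM, pN, wM, wN, ?_⟩
    have := le_rpow_of_le_mul_rpow (P := M * N) (c := H ^ 2 * (K * L) ^ (α * β)) (ε := ε)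
      (by positivity) hε1 (by
        refine (mul_le_mul lM lN pN.le (by positivity)).trans (le_of_eq ?_)
        rw [hε, Real.rpow_mul (by positivity), Real.rpow_mul (by positivity),
          Real.mul_rpow (by positivity) (by positivity),
          Real.mul_rpow (by positivity) (by positivity),
          Real.mul_rpow pM.le pN.le, Real.mul_rpow hK.le hL.le,
          Real.mul_rpow (by positivity) (by positivity),
          Real.mul_rpow (by positivity) (by positivity)]
        ring)
    rw [Real.mul_rpow (by positivity) (by positivity), ← Real.rpow_mul (by positivity),
      mul_one_div, hαβ] at this
    exact this
  set δ := (Q - ρ) / (σ - ρ) with hδ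
  have hδ0 : 0 < δ := by positivity
  set d := Q / (Q - ρ) + σ / (σ - Q)
  have hd : 0 < d := by positivity
  -- the interpolation inequality for `L^Q`, with the optimal cutting height
  have interp : ∀ {u : V → ℂ} {A B : ℝ}, 0 < A → 0 < B → HasWeakBound volume ρ A u →
      HasWeakBound volume σ B u → AEStronglyMeasurable u →
      ∫⁻ x, ENNReal.ofReal (‖u x‖ ^ Q) ≤ ENNReal.ofReal (d * (A * (B / A) ^ δ)) := by
    intro u A B hA hB wA wB hu
    have hBA : 0 < B / A := by positivity
    refine (wA.lintegral_rpow_le wB hu hA.le hB.le hQ (by linarith) (by linarith)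
      (T := (B / A) ^ (1 / (σ - ρ))) (by positivity)).trans (le_of_eq ?_)
    have e1 : ((B / A) ^ (1 / (σ - ρ))) ^ (Q - ρ) = (B / A) ^ δ := by
      rw [← Real.rpow_mul hBA.le, one_div_mul_eq_div]
    have e2 : B * ((B / A) ^ (1 / (σ - ρ))) ^ (Q - σ) = A * (B / A) ^ δ := by
      rw [← Real.rpow_mul hBA.le,
        show 1 / (σ - ρ) * (Q - σ) = δ - 1 by rw [hδ]; field_simp; ring,
        Real.rpow_sub_one hBA.ne']
      field_simp
    rw [e1, e2]
    congr 1
    ring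
  refine ⟨(d ^ 2 * ((H ^ 2) ^ (1 / (1 - ε))) ^ δ) ^ (1 / Q), by positivity,
    fun f g K L hK hL h hf hg mf mg hf0 => ?_⟩
  obtain ⟨M, N, pM, pN, wM, wN, hMN⟩ := key f g K L hK hL h hf hg mf mg hf0
  obtain ⟨-, lf⟩ := memLp_of_lintegral_rpow_le hQ mf.1 (by positivity) (interp hK pM hf wM mf.1)
  obtain ⟨-, lg⟩ := memLp_of_lintegral_rpow_le hQ mg.1 (by positivity) (interp hL pN hg wN mg.1)
  rw [← ENNReal.ofReal_toReal mf.2.ne, ← ENNReal.ofReal_toReal mg.2.ne,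
    ← ENNReal.ofReal_mul ENNReal.toReal_nonneg]
  refine ENNReal.ofReal_le_ofReal
    ((mul_le_mul lf lg ENNReal.toReal_nonneg (by positivity)).trans ?_)
  rw [← Real.mul_rpow (by positivity) (by positivity)]
  have hX : 0 < K * L := by positivity
  have e1 : (K * L) ^ (1 / ρ) = ((K * L) ^ (Q / ρ)) ^ (1 / Q) := by
    rw [← Real.rpow_mul hX.le]; congr 1; field_simp
  rw [e1, ← Real.mul_rpow (by positivity) (by positivity)]
  refine Real.rpow_le_rpow (by positivity) ?_ (by positivity)
  have e2 : (K * L) ^ (Q / ρ) = (K * L) * ((K * L) ^ (σ / ρ) / (K * L)) ^ δ := by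
    rw [← Real.rpow_sub_one hX.ne', ← Real.rpow_mul hX.le, ← Real.rpow_one_add' hX.le]
    · congr 1; rw [hδ]; field_simp; ring
    · have : 0 ≤ (σ / ρ - 1) * δ := by
        refine mul_nonneg ?_ hδ0.le
        rw [sub_nonneg, one_le_div hρ]; linarith
      linarith
  calc d * (K * (M / K) ^ δ) * (d * (L * (N / L) ^ δ))
      = d ^ 2 * (K * L) * (M * N / (K * L)) ^ δ := by
        rw [mul_div_mul_comm, Real.mul_rpow (by positivity) (by positivity)]; ring
    _ ≤ d ^ 2 * (K * L) * ((H ^ 2) ^ (1 / (1 - ε)) * (K * L) ^ (σ / ρ) / (K * L)) ^ δ := by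
        gcongr
    _ = _ := by
        rw [e2, mul_div_assoc, Real.mul_rpow (by positivity) (by positivity)]
        ring

/-- The uncertainty principle for weak norms at the exponent `ρ`. The constants `K` and `L` are `ρ`-th
powers of weak norms, which explains the exponent `1 / ρ`. -/
theorem IsFourierPair.exists_bound {ρ : ℝ} {q : ℝ≥0∞} (hρ : 0 < ρ)
    (hlt : ENNReal.ofReal ρ < min 2 q)
    (hconj : 1 ≤ ENNReal.ofReal ρ → q < ENNReal.conjExponent (ENNReal.ofReal ρ)) :
    ∃ C : ℝ, 0 < C ∧ ∀ (f g : V → ℂ) (K L : ℝ), 0 < K → 0 < L → IsFourierPair f g →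
      HasWeakBound volume ρ K f → HasWeakBound volume ρ L g → MemLp f q → MemLp g q →
      (∃ r : ℝ≥0∞, 1 ≤ r ∧ MemLp f r) → ¬ f =ᵐ[volume] 0 →
      eLpNorm f q volume * eLpNorm g q volume ≤ ENNReal.ofReal (C * (K * L) ^ (1 / ρ)) := by
  obtain ⟨hlt2, hltq⟩ := lt_min_iff.1 hlt
  rcases lt_or_ge ρ 1 with h1 | h1
  · obtain ⟨C, hC, h⟩ := IsFourierPair.exists_bound_of_lt_one (V := V) hρ h1 hltq
    exact ⟨C, hC, fun f g K L hK hL hfg hf hg _ mg hr hf0 =>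
      h f g K L hK hL hfg hf hg mg.1 hr hf0⟩
  have hc := hconj (by simpa using h1)
  obtain ⟨Q, hQ, rfl⟩ : ∃ Q : ℝ, ρ < Q ∧ q = ENNReal.ofReal Q :=
    ⟨q.toReal, (ENNReal.ofReal_lt_iff_lt_toReal hρ.le hc.ne_top).1 hltq,
      (ENNReal.ofReal_toReal hc.ne_top).symm⟩
  have hρ2 : ρ < 2 := by
    rw [← ENNReal.ofReal_ofNat] at hlt2
    exact (ENNReal.ofReal_lt_ofReal_iff two_pos).1 hlt2
  have hQ1 : 0 < Q - 1 := by linarith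
  have hρQ : ρ < Q / (Q - 1) := by
    rw [lt_div_iff₀ hQ1]
    rcases h1.eq_or_lt with rfl | h1
    · linarith
    have h1' : 0 < ρ - 1 := by linarith
    rw [ENNReal.conjExponent, ← ENNReal.ofReal_one, ← ENNReal.ofReal_sub _ zero_le_one,
      ← ENNReal.ofReal_inv_of_pos h1', ← ENNReal.ofReal_add zero_le_one (by positivity),
      ENNReal.ofReal_lt_ofReal_iff (by positivity), ← sub_lt_iff_lt_add',
      ← one_div, lt_div_iff₀ h1'] at hc
    linarith
  obtain ⟨s, hs, hs'⟩ := exists_between (lt_min hρ2 (lt_min hQ hρQ))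
  obtain ⟨hs2, hs''⟩ := lt_min_iff.1 hs'
  obtain ⟨hsQ, hsQ'⟩ := lt_min_iff.1 hs''
  have hQs : Q < s / (s - 1) := by
    rw [lt_div_iff₀ (by linarith)]
    rw [lt_div_iff₀ hQ1] at hsQ'
    linarith
  obtain ⟨C, hC, h⟩ := IsFourierPair.exists_bound_of_lt_two (V := V) hρ hs (by linarith) hs2 hsQ hQs
  exact ⟨C, hC, fun f g K L hK hL hfg hf hg mf mg _ hf0 =>
    h f g K L hK hL hfg hf hg mf mg hf0⟩

end Core

/-! ### The uncertainty principle for weighted norms -/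

theorem corollary3 (n : ℕ) (hn : 0 < n) (θ : ℝ) (hθ : 0 < θ) (p q : ℝ≥0∞)
    (hp : 0 < p) (hq : 0 < q)
    (hlt : criticalExponent n p θ < min 2 q)
    (hconj : 1 ≤ criticalExponent n p θ → q < ENNReal.conjExponent (criticalExponent n p θ)) :
    ∃ C : ℝ, 0 < C ∧
      ∀ f fhat : EuclideanSpace ℝ (Fin n) → ℂ,
        MemLpFourierLp q f fhat → ¬ (f =ᵐ[volume] 0) →
          ENNReal.ofReal C ≤
            (weightedLpNorm θ p f / eLpNorm f q volume) *
              (weightedLpNorm θ p fhat / eLpNorm fhat q volume) := by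
  rw [criticalExponent_eq_ofReal hθ hp] at hlt hconj
  set ρ : ℝ := n / (n * (p⁻¹).toReal + θ) with hρdef
  have hρ : 0 < ρ := by
    have : (0 : ℝ) < n := by exact_mod_cast hn
    positivity
  set ω : ℝ := (volume (Metric.ball (0 : EuclideanSpace ℝ (Fin n)) 1)).toReal + 1
  have hω : 0 < ω := by positivity
  obtain ⟨C, hC, core⟩ :=
    IsFourierPair.exists_bound (V := EuclideanSpace ℝ (Fin n)) hρ hlt hconj
  have hpi : 0 < 2 * Real.pi := by positivity
  have hpi1 : 1 ≤ 2 * Real.pi := by linarith [Real.two_le_pi]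
  -- `D` is the effect on the `L^q` norm of the dilation by `2π` between the two normalisations
  set D : ℝ := ((2 * Real.pi) ^ n)⁻¹ ^ (1 / q).toReal
  have hD : 0 < D := by positivity
  set E : ℝ := C * (ω ^ 2) ^ (1 / ρ) with hE
  have hE0 : 0 < E := by positivity
  refine ⟨D / E, by positivity, fun f g h hf0 => ?_⟩
  have pair := h.isFourierTransform.isFourierPair
  obtain ⟨Gm, Ge⟩ := eLpNorm_comp_dilation hpi q h.memLp_fourier.1
  rw [ENNReal.ofReal_rpow_of_pos (by positivity)] at Ge
  have hG0 := pair.not_ae_eq_zero hf0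
  have hG : MemLp (fun ξ => g ((2 * Real.pi) • ξ)) q :=
    ⟨Gm, by rw [Ge]; exact ENNReal.mul_lt_top ENNReal.ofReal_lt_top h.memLp_fourier.2⟩
  have hg0 : ¬ g =ᵐ[volume] 0 := fun hg => by
    refine hG0 ((eLpNorm_eq_zero_iff Gm hq.ne').1 ?_)
    rw [Ge, (eLpNorm_eq_zero_iff h.memLp_fourier.1 hq.ne').2 hg, mul_zero]
  have nf : eLpNorm f q volume ≠ 0 := fun h0 => hf0 ((eLpNorm_eq_zero_iff h.memLp.1 hq.ne').1 h0)
  have ng : eLpNorm g q volume ≠ 0 := fun h0 =>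
    hg0 ((eLpNorm_eq_zero_iff h.memLp_fourier.1 hq.ne').1 h0)
  have wf : weightedLpNorm θ p f ≠ 0 := fun h0 =>
    hf0 (ae_eq_zero_of_weightedLpNorm_eq_zero hn hθ hp h.memLp.1 h0)
  have wg : weightedLpNorm θ p g ≠ 0 := fun h0 =>
    hg0 (ae_eq_zero_of_weightedLpNorm_eq_zero hn hθ hp h.memLp_fourier.1 h0)
  -- an infinite numerator makes the product infinite, since no factor vanishes
  by_cases tf : weightedLpNorm θ p f = ∞
  · rw [tf, ENNReal.top_div_of_ne_top h.memLp.2.ne, ENNReal.top_mul]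
    · exact le_top
    · exact (ENNReal.div_pos wg h.memLp_fourier.2.ne).ne'
  by_cases tg : weightedLpNorm θ p g = ∞
  · rw [tg, ENNReal.top_div_of_ne_top h.memLp_fourier.2.ne, ENNReal.mul_top]
    · exact le_top
    · exact (ENNReal.div_pos wf h.memLp.2.ne).ne'
  set A := (weightedLpNorm θ p f).toReal
  set B := (weightedLpNorm θ p g).toReal
  have hA : 0 < A := ENNReal.toReal_pos wf tf
  have hB : 0 < B := ENNReal.toReal_pos wg tg
  have eA : weightedLpNorm θ p f = ENNReal.ofReal A := (ENNReal.ofReal_toReal tf).symm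
  have eB : weightedLpNorm θ p g = ENNReal.ofReal B := (ENNReal.ofReal_toReal tg).symm
  have main := core f _ (ω * A ^ ρ) (ω * B ^ ρ) (by positivity) (by positivity) pair
    (hasWeakBound_of_weightedLpNorm_le hn hθ hp h.memLp.1 hA eA.le)
    ((hasWeakBound_of_weightedLpNorm_le hn hθ hp h.memLp_fourier.1 hB eB.le).comp_dilation hpi1)
    h.memLp hG h.domain hf0
  have hpow : C * (ω * A ^ ρ * (ω * B ^ ρ)) ^ (1 / ρ) = E * (A * B) := by
    rw [show ω * A ^ ρ * (ω * B ^ ρ) = ω ^ 2 * (A * B) ^ ρ by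
        rw [Real.mul_rpow hA.le hB.le]; ring,
      Real.mul_rpow (by positivity) (by positivity), ← Real.rpow_mul (by positivity),
      mul_one_div_cancel hρ.ne', Real.rpow_one, hE]
    ring
  rw [hpow, Ge] at main
  rw [eA, eB]
  set x := (eLpNorm f q volume).toReal
  set y := (eLpNorm g q volume).toReal
  have hx : 0 < x := ENNReal.toReal_pos nf h.memLp.2.ne
  have hy : 0 < y := ENNReal.toReal_pos ng h.memLp_fourier.2.ne
  have ex : eLpNorm f q volume = ENNReal.ofReal x := (ENNReal.ofReal_toReal h.memLp.2.ne).symm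
  have ey : eLpNorm g q volume = ENNReal.ofReal y :=
    (ENNReal.ofReal_toReal h.memLp_fourier.2.ne).symm
  rw [ex, ey, ← ENNReal.ofReal_mul hD.le, ← ENNReal.ofReal_mul hx.le,
    ENNReal.ofReal_le_ofReal_iff (by positivity)] at main
  rw [ex, ey, ← ENNReal.ofReal_div_of_pos hx, ← ENNReal.ofReal_div_of_pos hy,
    ← ENNReal.ofReal_mul (by positivity)]
  refine ENNReal.ofReal_le_ofReal ?_
  rw [div_mul_div_comm, div_le_div_iff₀ hE0 (by positivity)]
  linarith
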